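/- Notation. $P(\omega)$ carries the Cantor topology; $[\omega]^\omega$ and $\mathrm{Fin}$ are the families of infinite and of finite subsets of $\omega$. An element $d\in[\omega]^\omega$ is identified with its increasing enumeration. $A_{\mathrm M}$ denotes $A\subseteq P(\omega)$ with the Michael subspace topology: points of $\mathrm{Fin}$ have their usual neighborhoods in $P(\omega)$, points of $[\omega]^\omega$ are isolated. $\mathrm{cov}(\mathcal M)$ is the least cardinality of a family of meager subsets of $[\omega]^\omega$ whose union is $[\omega]^\omega$. For an infinite cardinal $\kappa$, a set $X\subseteq[\omega]^\omega$ is $\kappa$-fin-unbounded if $|X|\ge\kappa$ and for each $d\in[\omega]^\omega$ there is $S\subseteq X$ with $|S|<\kappa$ such that for every finite $F\subseteq X\setminus S$ we have $\bigcup F\cap[d(n),d(n+1))=\emptyset$ for infinitely many $n$. An open cover $\mathcal U$ of a space $Z$ is an $\omega$-cover if $Z\notin\mathcal U$ and each finite subset of $Z$ is contained in a member of $\mathcal U$; it is a $\gamma$-cover if it is infinite and each point of $Z$ belongs to all but finitely many members of $\mathcal U$. $\mathrm O,\Omega,\Gamma$ are the classes of open covers, open $\omega$-covers and open $\gamma$-covers,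 and $\Omega_{\mathrm{ctbl}}$ is the class of countable open $\omega$-covers. $Z$ satisfies $\mathsf S_1(\mathcal A,\mathcal B)$ if for all covers $\mathcal U_0,\mathcal U_1,\dots\in\mathcal A$ of $Z$ there are $U_n\in\mathcal U_n$ with $\{U_n:n\in\omega\}\in\mathcal B$. The $\gamma$-property is $\mathsf S_1(\Omega,\Gamma)$; the Rothberger property is $\mathsf S_1(\mathrm O,\mathrm O)$. Theorem. Let $\kappa\le\mathrm{cov}(\mathcal M)$ be an infinite cardinal such that $\kappa$ is regular or $\kappa<\mathrm{cov}(\mathcal M)$. Let $X$ be a $\kappa$-fin-unbounded set and let $Y\subseteq P(\omega)$ be a set with the $\gamma$-property. Then: 1. $(X\cup\mathrm{Fin})_{\mathrm M}\times Y$ satisfies $\mathsf S_1(\Omega_{\mathrm{ctbl}},\Omega)$; and if all its finite powers are Lindelöf, it satisfies $\mathsf S_1(\Omega,\Omega)$. 2. For every natural number $k$, $(X\cup\mathrm{Fin})_{\mathrm M}^k\times Y$ satisfies $\mathsf S_1(\Omega_{\mathrm{ctbl}},\Omega)$; and if all its finite powers are Lindelöf, it satisfies $\mathsf S_1(\Omega,\Omega)$.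 3. For every natural number $k$, $(X\cup\mathrm{Fin})^k\times Y$ (with the standard topology) satisfies $\mathsf S_1(\Omega,\Omega)$. 4. $X\cup\mathrm{Fin}$ satisfies $\mathsf S_1(\Omega,\Omega)$. 5. For every natural number $k$, $(X\cup\mathrm{Fin})^k$ is Rothberger. -/

import Mathlib

open Cardinal Topology

/-! ### The Cantor space `P(ω)` -/

/-- The Cantor topology on `P(ω)`: subsets of `ω` are identified with their characteristic
functions in the product `{0,1}^ω` of discrete two-point spaces. -/
noncomputable instance cantorTopology : TopologicalSpace (Set ℕ) :=
  TopologicalSpace.induced (fun (a : Set ℕ) (n : ℕ) => (@decide (n ∈ a) (Classical.dec _) : Bool))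
    inferInstance

/-- The family `[ω]^ω` of all infinite subsets of `ω`. -/
def Roth : Set (Set ℕ) := {a | a.Infinite}

/-- The family `Fin` of all finite subsets of `ω`. -/
def FinSets : Set (Set ℕ) := {a | a.Finite}

/-- For an infinite set `a ⊆ ω`, the `n`-th element `a(n)` of its increasing enumeration. -/
noncomputable def enum (a : Set ℕ) (n : ℕ) : ℕ := Nat.nth (fun i => i ∈ a) n

/-! ### The Michael topology -/

/-- The set `P(ω)`, as a carrier of the Michael topology. -/
@[ext] structure Michael : Type where
  /-- The underlying subset of `ω`. -/
  toSet : Set ℕ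

/-- The Michael topology on `P(ω)`: finite sets have their usual neighborhoods and infinite sets
are isolated. -/
instance michaelTopology : TopologicalSpace Michael where
  IsOpen U := ∀ a ∈ U, a.toSet ∈ FinSets → {b : Set ℕ | Michael.mk b ∈ U} ∈ 𝓝 a.toSet
  isOpen_univ := fun _ _ _ => Filter.univ_mem
  isOpen_inter := fun _ _ hU hV a ha hf => Filter.inter_mem (hU a ha.1 hf) (hV a ha.2 hf)
  isOpen_sUnion := fun _ hs a ⟨U, hU, ha⟩ hf =>
    Filter.mem_of_superset (hs U hU a ha hf) fun _ hb => ⟨U, hU, hb⟩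

/-- For `A ⊆ P(ω)`, the subspace `A_M` of `P(ω)` with the Michael topology. -/
abbrev MichaelSubspace (A : Set (Set ℕ)) : Type := {a : Michael // a.toSet ∈ A}

/-! ### `κ`-fin-unbounded sets and `cov(𝓜)` -/

/-- `X ⊆ [ω]^ω` is `κ`-fin-unbounded: `|X| ≥ κ`, and for each `d ∈ [ω]^ω` there is `S ⊆ X` with
`|S| < κ` such that for every finite `F ⊆ X \ S` the union of `F` is disjoint from infinitely many
of the intervals `[d(n), d(n+1))`. -/
def IsFinUnbounded (κ : Cardinal.{0}) (X : Set (Set ℕ)) : Prop :=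
  X ⊆ Roth ∧ κ ≤ #X ∧
    ∀ d ∈ Roth, ∃ S ⊆ X, #S < κ ∧
      ∀ F ⊆ X \ S, F.Finite →
        {n : ℕ | ⋃₀ F ∩ Set.Ico (enum d n) (enum d (n + 1)) = ∅}.Infinite

/-- `cov(𝓜)`: the minimal cardinality of a family of meager subsets of `[ω]^ω` whose union is
`[ω]^ω`. -/
noncomputable def covMeager : Cardinal.{0} :=
  sInf {c | ∃ 𝓕 : Set (Set Roth), (∀ M ∈ 𝓕, IsMeagre M) ∧ ⋃₀ 𝓕 = Set.univ ∧ #𝓕 = c}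

/-! ### Covers and selection principles -/

section Covers

variable (Z : Type) [TopologicalSpace Z]

/-- The class of open covers of `Z`. -/
def OpenCovers : Set (Set (Set Z)) :=
  {𝓤 | (∀ U ∈ 𝓤, IsOpen U) ∧ ⋃₀ 𝓤 = Set.univ}

/-- The class of open `ω`-covers of `Z`. -/
def OmegaCovers : Set (Set (Set Z)) :=
  {𝓤 | 𝓤 ∈ OpenCovers Z ∧ Set.univ ∉ 𝓤 ∧ ∀ F : Set Z, F.Finite → ∃ U ∈ 𝓤, F ⊆ U}

/-- The class of countable open `ω`-covers of `Z`. -/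
def CountableOmegaCovers : Set (Set (Set Z)) :=
  {𝓤 | 𝓤 ∈ OmegaCovers Z ∧ 𝓤.Countable}

/-- The class of open `γ`-covers of `Z`. -/
def GammaCovers : Set (Set (Set Z)) :=
  {𝓤 | 𝓤 ∈ OpenCovers Z ∧ 𝓤.Infinite ∧ ∀ z : Z, {U ∈ 𝓤 | z ∉ U}.Finite}

end Covers

/-- The selection principle `S₁(𝓐, 𝓑)`, for classes `𝓐`, `𝓑` of covers of `Z`. -/
def SelOne {Z : Type} (𝓐 𝓑 : Set (Set (Set Z))) : Prop :=
  ∀ 𝓤 : ℕ → Set (Set Z), (∀ n, 𝓤 n ∈ 𝓐) →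
    ∃ V : ℕ → Set Z, (∀ n, V n ∈ 𝓤 n) ∧ Set.range V ∈ 𝓑

/-- The `γ`-property `S₁(Ω, Γ)`. -/
def GammaProperty (Z : Type) [TopologicalSpace Z] : Prop :=
  SelOne (OmegaCovers Z) (GammaCovers Z)

/-- The Rothberger property `S₁(O, O)`. -/
def Rothberger (Z : Type) [TopologicalSpace Z] : Prop :=
  SelOne (OpenCovers Z) (OpenCovers Z)

/-! The core is that `(X ∪ Fin)_M ^ k × Y` satisfies `S₁(Ω_ctbl, Ω)`
(`selOne_countable_omega_michael_pow_prod`).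

Let `A ⊆ X` be finite and let `U` be an open set containing `(A ∪ P(m)) ^ k × G`, with `G ⊆ Y`
finite. Subsets of `m` have Cantor neighborhoods also in the Michael topology, and no neighborhoods
of points of `A` are needed, as `A` is finite. So for some `l > m` the set `U` contains every tuple
whose coordinates are in `A` or miss the interval `[m, l)`, times a neighborhood of `G`. Such
neighborhoods form an `ω`-cover of `Y`, so the `γ`-property of `Y` provides, for a sequence of
countable `ω`-covers and a fixed `A`, choices of a member `U` of the `n`-th cover and of an end `l`
for all pairs `(n, m)` such that each point of `Y` is good for all but finitely many pairs
(`exists_index_and_interval`).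

The choice of `U` depends on `A`. For fewer than `cov(𝓜)` sets `A`, a single selection guesses right
for every `A` and `m` at some `n` (`exists_guess`). Iterating correct guesses for `A`, from `m` to
the end `l` that belongs to it, gives an infinite set `d_A` of interval ends, and
`κ`-fin-unboundedness applied to `d_A` gives a set `T A` of size less than `κ` such that finite
subsets of `X \ T A` miss infinitely many of these intervals; finite sets of finite sets miss almost
all of them. Hence the selection captures every finite set built from `A`, `Fin` and `X \ T A`
(`exists_selection_of_small`).

The sets `T A` depend on the selection, so the construction is repeated on infinitely many blocks of
covers, with small sets `S 0 ⊆ S 1 ⊆ ⋯`, where `S (i + 1)` includes the sets `T A` for all finite `A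
⊆ S i`. A finite `F` satisfies `F ∩ S (i + 1) ⊆ S i` for some `i`, and then round `i` captures it.
That `κ` is regular or less than `cov(𝓜)` keeps all `S i` small (`exists_smallness`).

The remaining assertions follow: `S₁(Ω_ctbl, Ω)` passes to continuous images, in particular to
coarser topologies; it gives `S₁(Ω, Ω)` if all finite powers are Lindelöf, as holds for second
countable spaces; a one-point factor `Y` gives the powers of `X ∪ Fin` themselves; and `S₁(Ω, Ω)`
implies the Rothberger property. -/

/-! ### Selections in spaces with the `γ`-property -/

/-- The `γ`-property for indexed families that may contain the whole space: the selected
sets can be taken to be indexed by a countable set `ι` in such a way that every point belongs to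
`W i` for all but finitely many *indices* `i`. -/
theorem GammaProperty.exists_eventually_mem {Y : Type} [TopologicalSpace Y] (hY : GammaProperty Y)
    {ι : Type} [Denumerable ι] (𝓦' : ι → Set (Set Y)) (hopen' : ∀ i, ∀ W ∈ 𝓦' i, IsOpen W)
    (hfin' : ∀ i, ∀ G : Set Y, G.Finite → ∃ W ∈ 𝓦' i, G ⊆ W) :
    ∃ W : ι → Set Y, (∀ i, W i ∈ 𝓦' i) ∧ ∀ y, {i | y ∉ W i}.Finite := by
  suffices H : ∀ 𝓦 : ℕ → Set (Set Y), (∀ n, ∀ W ∈ 𝓦 n, IsOpen W) →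
      (∀ n, ∀ G : Set Y, G.Finite → ∃ W ∈ 𝓦 n, G ⊆ W) →
      ∃ W : ℕ → Set Y, (∀ n, W n ∈ 𝓦 n) ∧ ∀ y, {n | y ∉ W n}.Finite by
    obtain ⟨W, hW, hfinW⟩ := H (fun n => 𝓦' (Denumerable.ofNat ι n)) (fun n => hopen' _)
      (fun n => hfin' _)
    refine ⟨fun i => W (Encodable.encode i), fun i => ?_, fun y => ?_⟩
    · have := hW (Encodable.encode i)
      rwa [Denumerable.ofNat_encode] at this
    · exact (hfinW y).preimage (Encodable.encode_injective.injOn)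
  intro 𝓦 hopen hfin
  by_cases huniv : ∀ n, Set.univ ∈ 𝓦 n
  · exact ⟨fun _ => Set.univ, huniv, fun y => by simp⟩
  push Not at huniv
  obtain ⟨n₀, hn₀⟩ := huniv
  -- Selecting from common refinements of the first families gives sets that can be moved to
  -- earlier indices; starting at `n₀` keeps the whole space out of them.
  let 𝓤 : ℕ → Set (Set Y) := fun n =>
    {U | ∃ w : ℕ → Set Y, (∀ i, w i ∈ 𝓦 i) ∧ U = ⋂ i ∈ Set.Iic (n + n₀), w i}
  have hω : ∀ n, 𝓤 n ∈ OmegaCovers Y := by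
    intro n
    have hcov : ∀ F : Set Y, F.Finite → ∃ U ∈ 𝓤 n, F ⊆ U := by
      intro F hF
      choose w hw hFw using fun i => hfin i F hF
      exact ⟨_, ⟨w, hw, rfl⟩, Set.subset_iInter₂ fun i _ => hFw i⟩
    refine ⟨⟨?_, ?_⟩, ?_, hcov⟩
    · rintro U ⟨w, hw, rfl⟩
      exact (Set.finite_Iic _).isOpen_biInter fun i _ => hopen i _ (hw i)
    · refine Set.eq_univ_of_forall fun y => ?_
      obtain ⟨U, hU, hyU⟩ := hcov {y} (Set.finite_singleton y)
      exact ⟨U, hU, hyU rfl⟩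
    · rintro ⟨w, hw, h⟩
      apply hn₀
      have : w n₀ = Set.univ := by
        refine Set.eq_univ_of_univ_subset ?_
        rw [h]
        exact Set.biInter_subset_of_mem (by simp)
      exact this ▸ hw n₀
  obtain ⟨V, hV, ⟨-, hinf, hγ⟩⟩ := hY 𝓤 hω
  choose w hw hVw using hV
  -- Enumerate infinitely many distinct selected sets.
  let φ := hinf.natEmbedding
  choose p hp using fun j => (φ j).2
  have hpinj : Function.Injective p := by
    intro i j hij
    apply φ.injective
    apply Subtype.ext
    rw [← hp i, ← hp j, hij]
  have hψ : ∀ n, ∃ j, n ≤ j ∧ n ≤ p j := by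
    intro n
    have h := hpinj.tendsto_cofinite
    rw [Nat.cofinite_eq_atTop] at h
    exact ((Filter.eventually_ge_atTop n).and (h.eventually_ge_atTop n)).exists
  choose ψ hψ₁ hψ₂ using hψ
  refine ⟨fun n => w (p (ψ n)) n, fun n => hw _ _, fun y => ?_⟩
  have hfin₁ : {j | y ∉ V (p j)}.Finite := by
    refine ((hγ y).preimage (f := fun j => (φ j : Set Y)) ?_).subset ?_
    · exact (Subtype.val_injective.comp φ.injective).injOn
    · intro j hj
      refine ⟨(φ j).2, ?_⟩
      change y ∉ (φ j : Set Y)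
      rw [← hp j]
      exact hj
  obtain ⟨J, hJ⟩ := hfin₁.bddAbove
  refine (Set.finite_Iic J).subset fun n hn => (hψ₁ n).trans (hJ fun hmem => hn ?_)
  rw [hVw] at hmem
  exact Set.mem_iInter₂.1 hmem n (by have := hψ₂ n; simp; omega)

/-! ### Neighborhoods in the Cantor and Michael topologies -/

theorem mem_nhds_cantor {a : Set ℕ} {s : Set (Set ℕ)} :
    s ∈ 𝓝 a ↔ ∃ l : ℕ, ∀ b : Set ℕ, (∀ t < l, t ∈ b ↔ t ∈ a) → b ∈ s := by
  rw [nhds_induced, Filter.mem_comap]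
  constructor
  · rintro ⟨u, hu, hus⟩
    rw [nhds_pi, Filter.mem_pi] at hu
    obtain ⟨I, hI, t, ht, htu⟩ := hu
    obtain ⟨l, hl⟩ := hI.bddAbove
    refine ⟨l + 1, fun b hb => hus (htu fun i hi => ?_)⟩
    have h := mem_of_mem_nhds (ht i)
    have hiff := hb i (Nat.lt_succ_of_le (hl hi))
    have heq : @decide (i ∈ b) (Classical.dec _) = @decide (i ∈ a) (Classical.dec _) := by
      simp [hiff]
    exact Set.mem_of_eq_of_mem heq h
  · rintro ⟨l, hl⟩
    refine ⟨(Set.Iio l).pi fun n => {@decide (n ∈ a) (Classical.dec _)}, ?_, ?_⟩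
    · exact set_pi_mem_nhds (Set.finite_Iio l) fun n _ => mem_nhds_discrete.2 rfl
    · intro b hb
      refine hl b fun t ht => ?_
      have := hb t ht
      simpa using this

theorem mem_nhds_michael {a : Michael} {s : Set Michael} (hs : s ∈ 𝓝 a) :
    ∃ l : ℕ, ∀ b : Michael,
      (b = a ∨ a.toSet.Finite ∧ ∀ t < l, t ∈ b.toSet ↔ t ∈ a.toSet) → b ∈ s := by
  obtain ⟨U, hUs, hU, haU⟩ := mem_nhds_iff.1 hs
  by_cases hfin : a.toSet.Finite
  · obtain ⟨l, hl⟩ := mem_nhds_cantor.1 (hU a haU hfin)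
    refine ⟨l, fun b hb => hUs ?_⟩
    rcases hb with rfl | ⟨-, hb⟩
    · exact haU
    · exact hl b.toSet hb
  · refine ⟨0, fun b hb => ?_⟩
    rcases hb with rfl | ⟨h, -⟩
    · exact hUs haU
    · exact absurd h hfin

theorem continuous_michael_toSet : Continuous Michael.toSet :=
  ⟨fun _ hU _ ha _ => hU.mem_nhds ha⟩

/-! ### Guessing functions with fewer than `cov(𝓜)` requirements -/

/-- The infinite sets `a` for which the least `t` with `⟨n, t⟩ ∈ a` equals `f n` for some `n` form
a comeager set. If there is no such `t`, the value is `0`, which only enlarges the set. -/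
theorem residual_decode_eq (f : ℕ → ℕ) :
    {a : Roth | ∃ n, sInf {t | Nat.pair n t ∈ a.1} = f n} ∈ residual Roth := by
  let D : Set Roth := {a | ∃ n, Nat.pair n (f n) ∈ a.1 ∧ ∀ t < f n, Nat.pair n t ∉ a.1}
  have hsub : D ⊆ {a : Roth | ∃ n, sInf {t | Nat.pair n t ∈ a.1} = f n} := by
    rintro a ⟨n, hn, hlt⟩
    refine ⟨n, le_antisymm (Nat.sInf_le hn) ?_⟩
    by_contra hlt'
    exact hlt _ (not_le.1 hlt') (Nat.sInf_mem (s := {t | Nat.pair n t ∈ a.1}) ⟨_, hn⟩)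
  refine Filter.mem_of_superset (residual_of_dense_open ?_ ?_) hsub
  · rw [isOpen_iff_mem_nhds]
    rintro a ⟨n, hn, hlt⟩
    rw [nhds_subtype_eq_comap, Filter.mem_comap]
    let N := Nat.pair n (f n) + 1
    refine ⟨{b | ∀ t < N, t ∈ b ↔ t ∈ a.1}, mem_nhds_cantor.2 ⟨N, fun b hb => hb⟩, ?_⟩
    intro b hb
    refine ⟨n, (hb _ (Nat.lt_succ_self _)).2 hn, fun t ht htb => hlt t ht ((hb _ ?_).1 htb)⟩
    exact (Nat.pair_lt_pair_right n ht).trans (Nat.lt_succ_self _)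
  · intro a
    rw [mem_closure_iff_nhds]
    intro s hs
    rw [nhds_subtype_eq_comap, Filter.mem_comap] at hs
    obtain ⟨u, hu, hus⟩ := hs
    obtain ⟨l, hl⟩ := mem_nhds_cantor.1 hu
    -- All codes `⟨l, t⟩` are at least `l`, so `a` may be changed there.
    let R : Set ℕ := (fun t => Nat.pair l t) '' Set.Iio (f l)
    let b : Set ℕ := insert (Nat.pair l (f l)) (a.1 \ R)
    have hb : b.Infinite :=
      (a.2.sdiff ((Set.finite_Iio _).image _)).mono (Set.subset_insert _ _)
    refine ⟨⟨b, hb⟩, hus (hl b fun t ht => ?_), l, Set.mem_insert _ _, fun t ht hmem => ?_⟩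
    · have h₁ : t ≠ Nat.pair l (f l) := by have := Nat.left_le_pair l (f l); omega
      have h₂ : t ∉ R := by
        rintro ⟨r, -, rfl⟩
        have := Nat.left_le_pair l r
        simp only at ht
        omega
      simp [b, h₁, h₂]
    · rcases hmem with h | h
      · have := (Nat.pair_eq_pair.1 h).2
        omega
      · exact h.2 ⟨t, ht, rfl⟩

/-- Fewer than `cov(𝓜)` many sequences of functions are guessed by a single function. -/
theorem exists_guess {I : Type} (hI : #I < covMeager) (f : I → ℕ → ℕ → ℕ) :
    ∃ e : ℕ → ℕ, ∀ i m, ∃ n, e n = f i m n := by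
  let B : I → Set Roth := fun i => {a | ∀ m, ∃ n, sInf {t | Nat.pair n t ∈ a.1} = f i m n}
  have hB : ∀ i, IsMeagre (B i)ᶜ := by
    intro i
    rw [IsMeagre, compl_compl]
    have : B i = ⋂ m, {a : Roth | ∃ n, sInf {t | Nat.pair n t ∈ a.1} = f i m n} := by
      ext a
      simp [B]
    rw [this]
    exact countable_iInter_mem.2 fun m => residual_decode_eq _
  by_contra hcon
  push Not at hcon
  refine hI.not_ge ((csInf_le' (s := {c | ∃ 𝓕 : Set (Set Roth), (∀ M ∈ 𝓕, IsMeagre M) ∧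
    ⋃₀ 𝓕 = Set.univ ∧ #𝓕 = c}) ⟨Set.range fun i => (B i)ᶜ, ?_, ?_, rfl⟩).trans mk_range_le)
  · rintro M ⟨i, rfl⟩
    exact hB i
  · refine Set.eq_univ_of_forall fun a => ?_
    obtain ⟨i, m, h⟩ := hcon fun n => sInf {t | Nat.pair n t ∈ a.1}
    refine ⟨_, ⟨i, rfl⟩, fun ha => ?_⟩
    obtain ⟨n, hn⟩ := ha m
    exact h n hn

/-! ### Covers and selection principles -/

theorem mem_omegaCovers_of_finite_subset {Z : Type} [TopologicalSpace Z] {𝓤 : Set (Set Z)}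
    (hopen : ∀ U ∈ 𝓤, IsOpen U) (huniv : Set.univ ∉ 𝓤)
    (hfin : ∀ F : Set Z, F.Finite → ∃ U ∈ 𝓤, F ⊆ U) : 𝓤 ∈ OmegaCovers Z := by
  refine ⟨⟨hopen, Set.eq_univ_of_forall fun z => ?_⟩, huniv, hfin⟩
  obtain ⟨U, hU, hz⟩ := hfin {z} (Set.finite_singleton z)
  exact ⟨U, hU, hz rfl⟩

/-- `S₁(Ω_ctbl, Ω)` is preserved by continuous surjections. -/
theorem SelOne.countable_omega_of_surjective {Z Z' : Type} [TopologicalSpace Z]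
    [TopologicalSpace Z'] (h : SelOne (CountableOmegaCovers Z) (OmegaCovers Z)) (g : Z → Z')
    (hg : Continuous g) (hsurj : Function.Surjective g) :
    SelOne (CountableOmegaCovers Z') (OmegaCovers Z') := by
  intro 𝓤 h𝓤
  obtain ⟨V, hV, hVω⟩ := h (fun n => (fun U => g ⁻¹' U) '' 𝓤 n) fun n => by
    refine ⟨mem_omegaCovers_of_finite_subset ?_ ?_ fun F hF => ?_, (h𝓤 n).2.image _⟩
    · rintro _ ⟨U, hU, rfl⟩
      exact ((h𝓤 n).1.1.1 U hU).preimage hg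
    · rintro ⟨U, hU, hUu⟩
      rw [Set.preimage_eq_univ_iff, hsurj.range_eq, Set.univ_subset_iff] at hUu
      exact (h𝓤 n).1.2.1 (hUu ▸ hU)
    · obtain ⟨U, hU, hFU⟩ := (h𝓤 n).1.2.2 (g '' F) (hF.image g)
      exact ⟨_, ⟨U, hU, rfl⟩, Set.image_subset_iff.1 hFU⟩
  choose W hW hWV using hV
  refine ⟨W, hW, mem_omegaCovers_of_finite_subset ?_ ?_ fun F hF => ?_⟩
  · rintro _ ⟨n, rfl⟩
    exact (h𝓤 n).1.1.1 _ (hW n)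
  · rintro ⟨n, hn⟩
    exact (h𝓤 n).1.2.1 (hn ▸ hW n)
  · obtain ⟨_, ⟨n, rfl⟩, hn⟩ := hVω.2.2 (Function.surjInv hsurj '' F) (hF.image _)
    refine ⟨_, ⟨n, rfl⟩, fun z hz => ?_⟩
    have hmem := hn (Set.mem_image_of_mem _ hz)
    rw [← hWV] at hmem
    simpa [Function.surjInv_eq hsurj] using hmem

/-- If all finite powers of `Z` are Lindelöf, then every open `ω`-cover of `Z` contains a countable
one, so `S₁(Ω_ctbl, Ω)` gives `S₁(Ω, Ω)`. -/
theorem SelOne.omega_of_lindelof_pow {Z : Type} [TopologicalSpace Z]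
    (h : SelOne (CountableOmegaCovers Z) (OmegaCovers Z))
    (hL : ∀ m : ℕ, LindelofSpace (Fin m → Z)) : SelOne (OmegaCovers Z) (OmegaCovers Z) := by
  have key : ∀ 𝓤 ∈ OmegaCovers Z, ∃ 𝓤' ⊆ 𝓤, 𝓤' ∈ CountableOmegaCovers Z := by
    intro 𝓤 h𝓤
    have hsub : ∀ m : ℕ, ∃ r : Set 𝓤, r.Countable ∧
        (Set.univ : Set (Fin m → Z)) ⊆ ⋃ U ∈ r, {x | ∀ i, x i ∈ U.1} := by
      intro m
      have := hL m
      refine isLindelof_univ.elim_countable_subcover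
        (fun U : 𝓤 => {x : Fin m → Z | ∀ i, x i ∈ U.1}) (fun U => ?_) fun x _ => ?_
      · simp only [Set.ofPred_forall]
        exact isOpen_iInter_of_finite fun i => (h𝓤.1.1 U.1 U.2).preimage (continuous_apply i)
      · obtain ⟨U, hU, hx⟩ := h𝓤.2.2 (Set.range x) (Set.finite_range x)
        exact Set.mem_iUnion.2 ⟨⟨U, hU⟩, fun i => hx ⟨i, rfl⟩⟩
    choose r hr hcov using hsub
    refine ⟨Subtype.val '' ⋃ m, r m, by simp, mem_omegaCovers_of_finite_subset ?_ ?_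
      fun F hF => ?_, (Set.countable_iUnion hr).image _⟩
    · rintro _ ⟨U, -, rfl⟩
      exact h𝓤.1.1 U.1 U.2
    · rintro ⟨U, -, hU⟩
      exact h𝓤.2.1 (hU ▸ U.2)
    · obtain ⟨m, x, -, rfl⟩ := hF.fin_param
      obtain ⟨U, hU, hx⟩ := Set.mem_iUnion₂.1 (hcov m (Set.mem_univ x))
      refine ⟨U.1, ⟨U, Set.mem_iUnion.2 ⟨m, hU⟩, rfl⟩, ?_⟩
      rintro _ ⟨i, rfl⟩
      exact hx i
  intro 𝓤 h𝓤
  choose 𝓤' hsub hω using fun n => key (𝓤 n) (h𝓤 n)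
  obtain ⟨V, hV, hVω⟩ := h 𝓤' hω
  exact ⟨V, fun n => hsub n (hV n), hVω⟩

/-- `S₁(Ω, Ω)` implies the Rothberger property: group a sequence of open covers into infinitely
many infinite blocks and select from the `ω`-covers of finite unions with one set from each of
finitely many members of a block.
The empty space is excluded because the empty family covers it. -/
theorem Rothberger.of_selOne_omega {Z : Type} [TopologicalSpace Z] [Nonempty Z]
    (h : SelOne (OmegaCovers Z) (OmegaCovers Z)) : Rothberger Z := by
  intro 𝓤 h𝓤
  have hpick : ∀ n (z : Z), ∃ U ∈ 𝓤 n, z ∈ U := fun n z =>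
    Set.mem_sUnion.1 ((h𝓤 n).2 ▸ Set.mem_univ z)
  choose c hc hzc using hpick
  suffices H : ∃ u : ℕ → ℕ → Set Z, (∀ n j, u n j ∈ 𝓤 (Nat.pair n j)) ∧ ∀ z, ∃ n j, z ∈ u n j by
    obtain ⟨u, hu, hcov⟩ := H
    refine ⟨fun i => u i.unpair.1 i.unpair.2, fun i => ?_, ?_, ?_⟩
    · simpa using hu i.unpair.1 i.unpair.2
    · rintro _ ⟨i, rfl⟩
      exact (h𝓤 _).1 _ (hu i.unpair.1 i.unpair.2)
    · refine Set.eq_univ_of_forall fun z => ?_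
      obtain ⟨n, j, hz⟩ := hcov z
      exact ⟨_, ⟨Nat.pair n j, rfl⟩, by simpa using hz⟩
  let 𝓥 : ℕ → Set (Set Z) := fun n =>
    {U | ∃ (u : ℕ → Set Z) (m : ℕ), (∀ j, u j ∈ 𝓤 (Nat.pair n j)) ∧ U = ⋃ j ∈ Set.Iio m, u j}
  obtain ⟨z₀⟩ := ‹Nonempty Z›
  by_cases huniv : ∃ n, Set.univ ∈ 𝓥 n
  · obtain ⟨n, u, m, hu, huu⟩ := huniv
    refine ⟨fun i j => if i = n then u j else c (Nat.pair i j) z₀, fun i j => ?_, fun z => ?_⟩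
    · dsimp only
      split_ifs with hi
      · exact hi ▸ hu j
      · exact hc _ _
    · obtain ⟨j, -, hj⟩ := Set.mem_iUnion₂.1 (huu ▸ Set.mem_univ z)
      exact ⟨n, j, by simpa using hj⟩
  · push Not at huniv
    obtain ⟨V, hV, hVω⟩ := h 𝓥 fun n => by
      refine mem_omegaCovers_of_finite_subset ?_ (huniv n) fun F hF => ?_
      · rintro _ ⟨u, m, hu, rfl⟩
        exact isOpen_biUnion fun j _ => (h𝓤 _).1 _ (hu j)
      · obtain ⟨m, x, -, rfl⟩ := hF.fin_param
        refine ⟨_, ⟨fun j => c (Nat.pair n j) (if hj : j < m then x ⟨j, hj⟩ else z₀), m,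
          fun j => hc _ _, rfl⟩, ?_⟩
        rintro _ ⟨i, rfl⟩
        refine Set.mem_iUnion₂.2 ⟨i, i.2, ?_⟩
        simpa using hzc (Nat.pair n i) (x i)
    choose u m hu hVu using hV
    refine ⟨u, hu, fun z => ?_⟩
    obtain ⟨_, ⟨n, rfl⟩, hz⟩ := Set.mem_sUnion.1 (hVω.1.2 ▸ Set.mem_univ z)
    rw [hVu] at hz
    obtain ⟨j, -, hj⟩ := Set.mem_iUnion₂.1 hz
    exact ⟨n, j, hj⟩

/-! ### The Galvin–Miller step for the Michael topology -/

theorem enum_range_of_strictMono {D : ℕ → ℕ} (hD : StrictMono D) : enum (Set.range D) = D := by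
  have hinf : (Set.ofPred fun i => i ∈ Set.range D).Infinite :=
    Set.infinite_range_of_injective hD.injective
  exact ((Nat.nth_strictMono hinf).range_inj hD).1 (Nat.range_nth_of_infinite hinf)

theorem finite_tuples {C B : Set (Set ℕ)} {k : ℕ} (hB : B.Finite) :
    {x : Fin k → MichaelSubspace C | ∀ i, (x i).1.toSet ∈ B}.Finite := by
  refine Set.Finite.pi' (t := fun _ => {a : MichaelSubspace C | a.1.toSet ∈ B}) fun _ => ?_
  refine hB.preimage (f := fun a : MichaelSubspace C => a.1.toSet) ?_
  exact fun a _ b _ hab => Subtype.ext (Michael.ext hab)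

theorem exists_prod_nbhd {C : Set (Set ℕ)} {k : ℕ} {Y : Type} [TopologicalSpace Y]
    {U : Set ((Fin k → MichaelSubspace C) × Y)} {x : Fin k → MichaelSubspace C} {y : Y}
    (hU : U ∈ 𝓝 (x, y)) :
    ∃ l₀ : ℕ, ∃ V : Set Y, IsOpen V ∧ y ∈ V ∧ ∀ l ≥ l₀, ∀ x' : Fin k → MichaelSubspace C,
      (∀ i, x' i = x i ∨ (x i).1.toSet.Finite ∧
        ∀ t < l, t ∈ (x' i).1.toSet ↔ t ∈ (x i).1.toSet) → ∀ y' ∈ V, (x', y') ∈ U := by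
  rw [nhds_prod_eq, Filter.mem_prod_iff] at hU
  obtain ⟨P, hP, V, hV, hPV⟩ := hU
  rw [nhds_pi, Filter.mem_pi] at hP
  obtain ⟨I, -, t, ht, htP⟩ := hP
  have hl : ∀ i, ∃ l : ℕ, ∀ b : MichaelSubspace C,
      (b = x i ∨ (x i).1.toSet.Finite ∧ ∀ t < l, t ∈ b.1.toSet ↔ t ∈ (x i).1.toSet) →
        b ∈ t i := by
    intro i
    have h := ht i
    rw [nhds_subtype_eq_comap, Filter.mem_comap] at h
    obtain ⟨s, hs, hst⟩ := h
    obtain ⟨l, hl⟩ := mem_nhds_michael hs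
    exact ⟨l, fun b hb => hst (hl b.1 (hb.imp_left (congrArg Subtype.val)))⟩
  choose l hl using hl
  obtain ⟨V', hV'V, hV', hyV'⟩ := mem_nhds_iff.1 hV
  refine ⟨Finset.univ.sup l, V', hV', hyV', fun l' hl' x' hx' y' hy' => hPV ⟨htP ?_, hV'V hy'⟩⟩
  intro i _
  refine hl i _ ((hx' i).imp_right fun h => ⟨h.1, fun s hs => h.2 s (hs.trans_le ?_)⟩)
  exact (Finset.le_sup (f := l) (Finset.mem_univ i)).trans hl'

/-- The `k`-tuples of elements of `C` each of which is in `A` or misses the interval `[m, l)`. -/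
def tuplesMissing (C A : Set (Set ℕ)) (k m l : ℕ) : Set (Fin k → MichaelSubspace C) :=
  {x | ∀ i, (x i).1.toSet ∈ A ∨ Disjoint (x i).1.toSet (Set.Ico m l)}

/-- An open set that contains all tuples built from a finite set `A` and the subsets of
`{0, …, m - 1}` contains all tuples built from `A` and the sets missing a suitable interval
`[m, l)`. Only the finite sets outside `A` are surrounded by neighborhoods; the possibly isolated
points of `A` are kept fixed. -/
theorem exists_tuplesMissing_prod_subset {C A : Set (Set ℕ)} (hFin : FinSets ⊆ C) (hA : A.Finite)
    {k : ℕ} {Y : Type} [TopologicalSpace Y] {U : Set ((Fin k → MichaelSubspace C) × Y)}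
    (hU : IsOpen U) (m : ℕ) {G : Set Y} (hG : G.Finite)
    (hsub : ∀ x : Fin k → MichaelSubspace C,
      (∀ i, (x i).1.toSet ∈ A ∪ 𝒫 (Set.Iio m)) → ∀ y ∈ G, (x, y) ∈ U) :
    ∃ l > m, ∃ W : Set Y, IsOpen W ∧ G ⊆ W ∧ tuplesMissing C A k m l ×ˢ W ⊆ U := by
  let Q : Set (Fin k → MichaelSubspace C) := {x | ∀ i, (x i).1.toSet ∈ A ∪ 𝒫 (Set.Iio m)}
  have hQ : Q.Finite := finite_tuples (hA.union (Set.finite_Iio m).finite_subsets)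
  have hloc : ∀ q : Q × G, ∃ l₀ : ℕ, ∃ V : Set Y, IsOpen V ∧ q.2.1 ∈ V ∧ ∀ l ≥ l₀,
      ∀ x' : Fin k → MichaelSubspace C, (∀ i, x' i = q.1.1 i ∨ (q.1.1 i).1.toSet.Finite ∧
        ∀ t < l, t ∈ (x' i).1.toSet ↔ t ∈ (q.1.1 i).1.toSet) → ∀ y' ∈ V, (x', y') ∈ U :=
    fun q => exists_prod_nbhd (hU.mem_nhds (hsub _ q.1.2 _ q.2.2))
  choose l₀ V hV hyV hVU using hloc
  have := hQ.to_subtype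
  have := hG.to_subtype
  obtain ⟨L, hL⟩ := (Set.finite_range l₀).bddAbove
  refine ⟨max L (m + 1), lt_max_of_lt_right (Nat.lt_succ_self m), ⋃ y : G, ⋂ x : Q, V (x, y),
    isOpen_iUnion fun y => isOpen_iInter_of_finite fun x => hV _,
    fun y hy => Set.mem_iUnion.2 ⟨⟨y, hy⟩, Set.mem_iInter.2 fun x => hyV (x, _)⟩, ?_⟩
  rintro ⟨x', y'⟩ ⟨hx', hy'⟩
  obtain ⟨y, hy⟩ := Set.mem_iUnion.1 hy'
  -- Replace the coordinates outside `A` by their traces on `{0, …, m - 1}`.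
  classical
  let x : Fin k → MichaelSubspace C := fun i =>
    if (x' i).1.toSet ∈ A then x' i
    else ⟨⟨(x' i).1.toSet ∩ Set.Iio m⟩, hFin ((Set.finite_Iio m).inter_of_right _)⟩
  have hx : x ∈ Q := by
    intro i
    by_cases h : (x' i).1.toSet ∈ A
    · simp only [x, if_pos h]
      exact Or.inl h
    · simp only [x, if_neg h]
      exact Or.inr Set.inter_subset_right
  refine hVU (⟨x, hx⟩, y) (max L (m + 1)) (le_max_of_le_left (hL ⟨_, rfl⟩)) x' (fun i => ?_) y'
    (Set.mem_iInter.1 hy ⟨x, hx⟩)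
  by_cases h : (x' i).1.toSet ∈ A
  · exact Or.inl (by simp only [x, if_pos h])
  · refine Or.inr ?_
    simp only [x, if_neg h]
    refine ⟨(Set.finite_Iio m).inter_of_right _, fun t ht => ⟨fun htx => ⟨htx, ?_⟩, And.left⟩⟩
    by_contra htm
    exact Set.disjoint_left.1 ((hx' i).resolve_left h) htx ⟨not_lt.1 htm, ht⟩

/-- For a finite set `A` and a sequence of `ω`-covers `range (u n)` of `C_M ^ k × Y`, the
`γ`-property of `Y` yields indices `e n m` and interval ends `l n m` such that for every `y` the
set `u n (e n m)` contains `tuplesMissing C A k m (l n m) × {y}` for all but finitely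
many pairs `(n, m)`. -/
theorem exists_index_and_interval {C A : Set (Set ℕ)} (hFin : FinSets ⊆ C) (hA : A.Finite)
    {k : ℕ} {Y : Type} [TopologicalSpace Y] (hY : GammaProperty Y)
    {u : ℕ → ℕ → Set ((Fin k → MichaelSubspace C) × Y)}
    (hu : ∀ n, Set.range (u n) ∈ OmegaCovers ((Fin k → MichaelSubspace C) × Y)) :
    ∃ e l : ℕ → ℕ → ℕ, (∀ n m, m < l n m) ∧ ∀ y, {q : ℕ × ℕ |
      ¬ ∀ x ∈ tuplesMissing C A k q.2 (l q.1 q.2), (x, y) ∈ u q.1 (e q.1 q.2)}.Finite := by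
  obtain ⟨W, hW, hWfin⟩ := hY.exists_eventually_mem
    (fun q : ℕ × ℕ => {W : Set Y | IsOpen W ∧ ∃ e l : ℕ, q.2 < l ∧
      tuplesMissing C A k q.2 l ×ˢ W ⊆ u q.1 e}) (fun q W hW => hW.1) fun q G hG => by
    let Q : Set (Fin k → MichaelSubspace C) := {x | ∀ i, (x i).1.toSet ∈ A ∪ 𝒫 (Set.Iio q.2)}
    have hQ : Q.Finite := finite_tuples (hA.union (Set.finite_Iio q.2).finite_subsets)
    obtain ⟨_, ⟨e, rfl⟩, he⟩ := (hu q.1).2.2 (Q ×ˢ G) (hQ.prod hG)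
    obtain ⟨l, hl, W, hWo, hGW, hW⟩ := exists_tuplesMissing_prod_subset hFin hA
      ((hu q.1).1.1 _ ⟨e, rfl⟩) q.2 hG fun x hx y hy => he ⟨hx, hy⟩
    exact ⟨W, ⟨hWo, e, l, hl, hW⟩, hGW⟩
  choose hWo e l hl hWu using hW
  refine ⟨fun n m => e (n, m), fun n m => l (n, m), fun n m => hl (n, m), fun y => ?_⟩
  exact (hWfin y).subset fun q hq hy => hq fun x hx => hWu q ⟨hx, hy⟩

/-- One round of the selection: for a set `S` with fewer than `cov(𝓜)` finite subsets there is a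
selection that captures, for each finite `A ⊆ S`, all finite sets built from `A`, from `Fin`
and from elements of `X` outside an exceptional set `T A` of size less than `κ`. -/
theorem exists_selection_of_small {κ : Cardinal.{0}} {X : Set (Set ℕ)} (hX : IsFinUnbounded κ X)
    {Y : Type} [TopologicalSpace Y] (hY : GammaProperty Y) {k : ℕ}
    {𝓤 : ℕ → Set (Set ((Fin k → MichaelSubspace (X ∪ FinSets)) × Y))}
    (h𝓤 : ∀ n, 𝓤 n ∈ CountableOmegaCovers ((Fin k → MichaelSubspace (X ∪ FinSets)) × Y))
    {S : Set (Set ℕ)} (hS : #(Finset S) < covMeager) :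
    ∃ V : ℕ → Set ((Fin k → MichaelSubspace (X ∪ FinSets)) × Y), (∀ n, V n ∈ 𝓤 n) ∧
      ∃ T : Finset S → Set (Set ℕ), (∀ A, T A ⊆ X ∧ #(T A) < κ) ∧
        ∀ (A : Finset S) (F E : Set (Set ℕ)) (G : Set Y), F.Finite → F ⊆ X \ T A → E.Finite →
          E ⊆ FinSets → G.Finite → ∃ n, ∀ x : Fin k → MichaelSubspace (X ∪ FinSets),
            (∀ i, (x i).1.toSet ∈ Subtype.val '' (A : Set S) ∪ (F ∪ E)) →
              ∀ y ∈ G, (x, y) ∈ V n := by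
  have hu : ∀ n, ∃ u : ℕ → _, 𝓤 n = Set.range u := fun n => by
    obtain ⟨U, hU, -⟩ := (h𝓤 n).1.2.2 ∅ Set.finite_empty
    exact (h𝓤 n).2.exists_eq_range ⟨U, hU⟩
  choose u hu using hu
  choose e l hl hel using fun A : Finset S =>
    exists_index_and_interval (C := X ∪ FinSets) (A := Subtype.val '' (A : Set S)) (u := u)
      Set.subset_union_right (A.finite_toSet.image _) hY fun n => hu n ▸ (h𝓤 n).1
  obtain ⟨g, hg⟩ := exists_guess hS fun A m n => e A n m
  choose ν hν using hg
  -- For each `A` the ends of the intervals at which `g` guesses correctly.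
  let D : Finset S → ℕ → ℕ := fun A j => Nat.rec 0 (fun _ m => l A (ν A m) m) j
  have hDsucc : ∀ A j, D A (j + 1) = l A (ν A (D A j)) (D A j) := fun _ _ => rfl
  have hD : ∀ A, StrictMono (D A) := fun A =>
    strictMono_nat_of_lt_succ fun j => by rw [hDsucc]; exact hl _ _ _
  choose T hTX hTκ hT using fun A => hX.2.2 (Set.range (D A))
    (Set.infinite_range_of_injective (hD A).injective)
  refine ⟨fun n => u n (g n), fun n => hu n ▸ ⟨_, rfl⟩, T, fun A => ⟨hTX A, hTκ A⟩, ?_⟩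
  intro A F E G hF hFX hE hEfin hG
  have hinf := hT A F hFX hF
  rw [enum_range_of_strictMono (hD A)] at hinf
  have hbad : {j | ∃ y ∈ G, ¬ ∀ x ∈ tuplesMissing (X ∪ FinSets) (Subtype.val '' (A : Set S)) k
      (D A j) (D A (j + 1)), (x, y) ∈ u (ν A (D A j)) (g (ν A (D A j)))}.Finite := by
    have : {j | ∃ y ∈ G, ¬ ∀ x ∈ tuplesMissing (X ∪ FinSets) (Subtype.val '' (A : Set S)) k
        (D A j) (D A (j + 1)), (x, y) ∈ u (ν A (D A j)) (g (ν A (D A j)))} =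
        ⋃ y ∈ G, (fun j => (ν A (D A j), D A j)) ⁻¹' {q : ℕ × ℕ | ¬ ∀ x ∈ tuplesMissing
          (X ∪ FinSets) (Subtype.val '' (A : Set S)) k q.2 (l A q.1 q.2),
            (x, y) ∈ u q.1 (e A q.1 q.2)} := by
      ext j
      simp only [Set.mem_ofPred_eq, Set.mem_iUnion, Set.mem_preimage, hDsucc, hν, exists_prop]
    rw [this]
    refine hG.biUnion fun y _ => (hel A y).preimage ?_
    exact fun i _ j _ hij => (hD A).injective (Prod.ext_iff.1 hij).2
  obtain ⟨N, hN⟩ := (hE.biUnion (t := id) hEfin).bddAbove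
  obtain ⟨j, hj, hjbad⟩ := (hinf.sdiff (hbad.union (Set.finite_Iic N))).nonempty
  simp only [Set.mem_union, not_or, Set.mem_ofPred_eq, not_exists, not_and, not_not, Set.mem_Iic,
    not_le] at hjbad
  refine ⟨ν A (D A j), fun x hx y hy => hjbad.1 y hy x fun i => ?_⟩
  rcases hx i with h | h | h
  · exact Or.inl h
  · refine Or.inr (Set.disjoint_left.2 fun t ht htj => ?_)
    exact Set.eq_empty_iff_forall_notMem.1 hj t ⟨⟨_, h, ht⟩, htj⟩
  · refine Or.inr (Set.disjoint_left.2 fun t ht htj => ?_)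
    have h₁ : t ≤ N := hN (Set.mem_biUnion h ht)
    have h₂ := (hD A).id_le j
    have h₃ := htj.1
    simp only [id] at h₂
    omega

/-! ### Iterating the selection -/

theorem mk_finset_lt_of_aleph0_le {κ : Cardinal.{0}} (hκ : ℵ₀ ≤ κ) {α : Type} (h : #α < κ) :
    #(Finset α) < κ := by
  rcases finite_or_infinite α with hfin | hinf
  · exact (Cardinal.lt_aleph0_of_finite _).trans_le hκ
  · rwa [Cardinal.mk_finset_of_infinite]

theorem mk_finset_le_of_aleph0_le {κ : Cardinal.{0}} (hκ : ℵ₀ ≤ κ) {α : Type} (h : #α ≤ κ) :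
    #(Finset α) ≤ κ := by
  rcases finite_or_infinite α with hfin | hinf
  · exact (Cardinal.lt_aleph0_of_finite _).le.trans hκ
  · rwa [Cardinal.mk_finset_of_infinite]

/-- A notion of smallness for sets that is preserved by adding a set of size less than `κ` for every
finite subset, and under which a small set has fewer than `cov(𝓜)` finite subsets: size less than
`κ` if `κ` is regular, and size at most `κ` if `κ < cov(𝓜)`. -/
theorem exists_smallness {κ : Cardinal.{0}} (hκ : ℵ₀ ≤ κ) (hκM : κ ≤ covMeager)
    (hreg : κ.IsRegular ∨ κ < covMeager) :
    ∃ P : Set (Set ℕ) → Prop, P ∅ ∧ ∀ S, P S → #(Finset S) < covMeager ∧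
      ∀ T : Finset S → Set (Set ℕ), (∀ A, #(T A) < κ) → P (S ∪ ⋃ A, T A) := by
  rcases hreg with hreg | hlt
  · refine ⟨fun S => #S < κ, by simpa using aleph0_pos.trans_le hκ, fun S hS => ?_⟩
    have hfin := mk_finset_lt_of_aleph0_le hκ hS
    refine ⟨hfin.trans_le hκM, fun T hT => (mk_union_le _ _).trans_lt ?_⟩
    refine add_lt_of_lt hκ hS (mk_iUnion_le_sum_mk.trans_lt ?_)
    exact sum_lt_of_isRegular hreg hfin hT
  · refine ⟨fun S => #S ≤ κ, by simp, fun S hS => ?_⟩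
    have hfin := mk_finset_le_of_aleph0_le hκ hS
    refine ⟨hfin.trans_lt hlt, fun T hT => (mk_union_le _ _).trans ?_⟩
    refine add_le_of_le hκ hS (mk_iUnion_le_sum_mk.trans ?_)
    calc Cardinal.sum (fun A => #(T A)) ≤ Cardinal.sum (fun _ : Finset S => κ) :=
          sum_le_sum _ _ fun A => (hT A).le
      _ = #(Finset S) * κ := by simp
      _ ≤ κ := mul_le_of_le hκ hfin le_rfl

theorem exists_inter_succ_subset {α : Type} {S : ℕ → Set α} (hS : Monotone S) {F : Set α}
    (hF : F.Finite) : ∃ i, F ∩ S (i + 1) ⊆ S i := by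
  by_contra! h
  simp only [Set.not_subset] at h
  choose x hx hxS using h
  have hinj : Function.Injective x := by
    have hne : ∀ i j, i < j → x i ≠ x j := fun i j hij heq =>
      hxS j (heq ▸ hS hij (hx i).2)
    intro i j hij
    by_contra h
    rcases lt_or_gt_of_ne h with h | h
    · exact hne i j h hij
    · exact hne j i h hij.symm
  exact Set.infinite_of_injective_forall_mem hinj (fun i => (hx i).1) hF

/-- The selection principle for `(X ∪ Fin)_M ^ k × Y`. The covers are split into infinitely many
blocks; round `i` handles the finite subsets of a small set `S i` and
adds the exceptional sets of that round to `S (i + 1)`. A finite `F ⊆ X` gains no new elements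
in some round `i`, and that round captures `F`. -/
theorem selOne_countable_omega_michael_pow_prod {κ : Cardinal.{0}} (hκ : ℵ₀ ≤ κ)
    (hκM : κ ≤ covMeager) (hreg : κ.IsRegular ∨ κ < covMeager) {X : Set (Set ℕ)}
    (hX : IsFinUnbounded κ X) {Y : Type} [TopologicalSpace Y] (hY : GammaProperty Y) (k : ℕ) :
    SelOne (CountableOmegaCovers ((Fin k → MichaelSubspace (X ∪ FinSets)) × Y))
      (OmegaCovers ((Fin k → MichaelSubspace (X ∪ FinSets)) × Y)) := by
  intro 𝓤 h𝓤
  obtain ⟨P, hP₀, hP⟩ := exists_smallness hκ hκM hreg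
  choose V hV T hT hcap using fun (i : ℕ) (S : {S // P S}) =>
    exists_selection_of_small hX hY (fun n => h𝓤 (Nat.pair i n)) (hP S.1 S.2).1
  let S : ℕ → {S // P S} := fun i => Nat.rec ⟨∅, hP₀⟩
    (fun i S => ⟨S.1 ∪ ⋃ A, T i S A, (hP S.1 S.2).2 _ fun A => (hT i S A).2⟩) i
  have hSsucc : ∀ i, (S (i + 1)).1 = (S i).1 ∪ ⋃ A, T i (S i) A := fun _ => rfl
  have hmono : Monotone fun i => (S i).1 :=
    monotone_nat_of_le_succ fun i => by rw [hSsucc]; exact Set.subset_union_left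
  refine ⟨fun p => V p.unpair.1 (S p.unpair.1) p.unpair.2, fun p => ?_, ?_⟩
  · simpa using hV p.unpair.1 (S p.unpair.1) p.unpair.2
  refine mem_omegaCovers_of_finite_subset ?_ ?_ fun H hH => ?_
  · rintro _ ⟨p, rfl⟩
    exact (h𝓤 _).1.1.1 _ (hV p.unpair.1 (S p.unpair.1) p.unpair.2)
  · rintro ⟨p, hp⟩
    exact (h𝓤 _).1.2.1 (Set.mem_of_eq_of_mem hp.symm (hV p.unpair.1 (S p.unpair.1) p.unpair.2))
  let F : Set (Set ℕ) := ⋃ z ∈ H, Set.range fun i => (z.1 i).1.toSet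
  have hF : F.Finite := hH.biUnion fun z _ => Set.finite_range _
  obtain ⟨i, hi⟩ := exists_inter_succ_subset hmono hF
  have hA : {s : (S i).1 | s.1 ∈ F}.Finite := hF.preimage Subtype.val_injective.injOn
  obtain ⟨n, hn⟩ := hcap i (S i) hA.toFinset ((F ∩ X) \ (S i).1) (F ∩ FinSets) (Prod.snd '' H)
    ((hF.subset Set.inter_subset_left).sdiff)
    (fun a ha => ⟨ha.1.2, fun haT => ha.2 (hi ⟨ha.1.1, Or.inr (Set.mem_iUnion.2 ⟨_, haT⟩)⟩)⟩)
    (hF.subset Set.inter_subset_left) Set.inter_subset_right (hH.image _)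
  refine ⟨_, ⟨Nat.pair i n, rfl⟩, fun z hz => ?_⟩
  have := hn z.1 (fun j => ?_) z.2 ⟨z, hz, rfl⟩
  · simpa using this
  · have hzF : (z.1 j).1.toSet ∈ F := Set.mem_biUnion hz ⟨j, rfl⟩
    by_cases hzS : (z.1 j).1.toSet ∈ (S i).1
    · exact Or.inl ⟨⟨_, hzS⟩, by simpa using hzF, rfl⟩
    · rcases (z.1 j).2 with h | h
      · exact Or.inr (Or.inl ⟨⟨hzF, h⟩, hzS⟩)
      · exact Or.inr (Or.inr ⟨hzF, h⟩)

/-! ### The standard topology -/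

instance : SecondCountableTopology (Set ℕ) :=
  TopologicalSpace.secondCountableTopology_induced _ _ _

/-- A finite space has no `ω`-covers, so the one-point space has the `γ`-property. -/
theorem gammaProperty_unit : GammaProperty Unit := by
  intro 𝓤 h𝓤
  obtain ⟨U, hU, hUu⟩ := (h𝓤 0).2.2 Set.univ Set.finite_univ
  exact absurd (Set.univ_subset_iff.1 hUu ▸ hU) (h𝓤 0).2.1

/-- The identity map from `C_M` to `C` with the standard topology. -/
def michaelToStandard (C : Set (Set ℕ)) (a : MichaelSubspace C) : C := ⟨a.1.toSet, a.2⟩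

theorem continuous_michaelToStandard (C : Set (Set ℕ)) : Continuous (michaelToStandard C) :=
  (continuous_michael_toSet.comp continuous_subtype_val).subtype_mk _

theorem surjective_michaelToStandard (C : Set (Set ℕ)) :
    Function.Surjective (michaelToStandard C) :=
  fun a => ⟨⟨⟨a.1⟩, a.2⟩, rfl⟩

theorem selOne_countable_omega_pow_prod {C : Set (Set ℕ)} {k : ℕ} {Y : Type} [TopologicalSpace Y]
    (h : SelOne (CountableOmegaCovers ((Fin k → MichaelSubspace C) × Y))
      (OmegaCovers ((Fin k → MichaelSubspace C) × Y))) :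
    SelOne (CountableOmegaCovers ((Fin k → C) × Y)) (OmegaCovers ((Fin k → C) × Y)) := by
  refine h.countable_omega_of_surjective
    (Prod.map (fun x i => michaelToStandard C (x i)) id) ?_ ?_
  · refine Continuous.prodMap ?_ continuous_id
    exact continuous_pi fun i => (continuous_michaelToStandard C).comp (continuous_apply i)
  · exact (Function.Surjective.piMap fun _ => surjective_michaelToStandard C).prodMap
      Function.surjective_id

theorem mainTheorem3 (κ : Cardinal.{0}) (hκ : ℵ₀ ≤ κ) (hκM : κ ≤ covMeager)
    (hreg : κ.IsRegular ∨ κ < covMeager)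
    (X : Set (Set ℕ)) (hX : IsFinUnbounded κ X)
    (Y : Set (Set ℕ)) (hY : GammaProperty Y) :
    -- `(X ∪ Fin)_M × Y`
    SelOne (CountableOmegaCovers (MichaelSubspace (X ∪ FinSets) × Y))
        (OmegaCovers (MichaelSubspace (X ∪ FinSets) × Y)) ∧
    ((∀ m : ℕ, LindelofSpace (Fin m → MichaelSubspace (X ∪ FinSets) × Y)) →
      SelOne (OmegaCovers (MichaelSubspace (X ∪ FinSets) × Y))
        (OmegaCovers (MichaelSubspace (X ∪ FinSets) × Y))) ∧
    -- `(X ∪ Fin)_M ^ k × Y`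
    (∀ k : ℕ,
      SelOne (CountableOmegaCovers ((Fin k → MichaelSubspace (X ∪ FinSets)) × Y))
          (OmegaCovers ((Fin k → MichaelSubspace (X ∪ FinSets)) × Y)) ∧
      ((∀ m : ℕ, LindelofSpace (Fin m → (Fin k → MichaelSubspace (X ∪ FinSets)) × Y)) →
        SelOne (OmegaCovers ((Fin k → MichaelSubspace (X ∪ FinSets)) × Y))
          (OmegaCovers ((Fin k → MichaelSubspace (X ∪ FinSets)) × Y)))) ∧
    -- `(X ∪ Fin) ^ k × Y`
    (∀ k : ℕ,
      SelOne (OmegaCovers ((Fin k → (X ∪ FinSets : Set (Set ℕ))) × Y))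
        (OmegaCovers ((Fin k → (X ∪ FinSets : Set (Set ℕ))) × Y))) ∧
    -- `X ∪ Fin`
    SelOne (OmegaCovers (X ∪ FinSets : Set (Set ℕ))) (OmegaCovers (X ∪ FinSets : Set (Set ℕ))) ∧
    -- `(X ∪ Fin) ^ k`
    (∀ k : ℕ, Rothberger (Fin k → (X ∪ FinSets : Set (Set ℕ)))) := by
  have hM := fun k => selOne_countable_omega_michael_pow_prod hκ hκM hreg hX hY k
  have hM₁ : SelOne (CountableOmegaCovers (MichaelSubspace (X ∪ FinSets) × Y))
      (OmegaCovers (MichaelSubspace (X ∪ FinSets) × Y)) :=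
    (hM 1).countable_omega_of_surjective (fun z => (z.1 0, z.2)) (by fun_prop)
      fun z => ⟨(fun _ => z.1, z.2), rfl⟩
  have hpow : ∀ k, SelOne (CountableOmegaCovers (Fin k → (X ∪ FinSets : Set (Set ℕ))))
      (OmegaCovers (Fin k → (X ∪ FinSets : Set (Set ℕ)))) := fun k =>
    (selOne_countable_omega_pow_prod (selOne_countable_omega_michael_pow_prod hκ hκM hreg hX
      gammaProperty_unit k)).countable_omega_of_surjective Prod.fst continuous_fst
      Prod.fst_surjective
  have : Nonempty (X ∪ FinSets : Set (Set ℕ)) := ⟨⟨∅, Or.inr Set.finite_empty⟩⟩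
  refine ⟨hM₁, fun hL => hM₁.omega_of_lindelof_pow hL,
    fun k => ⟨hM k, fun hL => (hM k).omega_of_lindelof_pow hL⟩, fun k => ?_, ?_, fun k => ?_⟩
  · exact (selOne_countable_omega_pow_prod (hM k)).omega_of_lindelof_pow fun m => inferInstance
  · exact ((hpow 1).countable_omega_of_surjective (fun x => x 0) (by fun_prop)
      fun a => ⟨fun _ => a, rfl⟩).omega_of_lindelof_pow fun m => inferInstance
  · exact .of_selOne_omega ((hpow k).omega_of_lindelof_pow fun m => inferInstance)
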